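/- **Theorem (Re-characterisation of supermaps).** *Setting.* Systems are finite-dimensional Hilbert spaces, each taken with an orthonormal basis, so a system is $\mathbb C^{A}$ for a finite set $A$ (we write $A$ for the system). The tensor product of systems is $A\otimes B=\mathbb C^{A\times B}$, the unit is $I=\mathbb C$, the dual system $A^*$ is identified with $\mathbb C^A$ through the basis, and the associativity and unit isomorphisms are left implicit. $\mathbf{CP}(A,B)$ is the set of completely positive linear maps $\mathcal L(A)\to\mathcal L(B)$ and $\mathbf{QC}(A,B)\subseteq\mathbf{CP}(A,B)$ is the set of quantum channels, i.e. of trace-preserving ones. States on $X$ are elements of $\mathbf{QC}(I,X)$ and effects on $X$ are elements of $\mathbf{QC}(X,I)$ (so the only effect is the trace). $\cup_A\in\mathbf{CP}(I,A^*\otimes A)$ and $\cap_A\in\mathbf{CP}(A\otimes A^*,I)$ are the unnormalised Bell state and Bell effect. For $K\subseteq\mathbf{QC}(A,A')$ the *dilation extension* $\mathrm{dExt}_{X,X'}(K)$ is the set of all $\Phi\in\mathbf{QC}(A\otimes X,A'\otimes X')$ such that $(\mathrm{id}_{A'}\otimes\sigma)\circ\Phi\circ(\mathrm{id}_A\otimes\rho)\in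 K$ for every state $\rho$ on $X$ and every effect $\sigma$ on $X'$. $K$ is *normal* if $\rho\circ d\in K$ for every effect $d\in\mathbf{QC}(A,I)$ and every state $\rho\in\mathbf{QC}(I,A')$, and *convex* if it is closed under convex combinations. Let $K\subseteq\mathbf{QC}(A,A')$ and $M\subseteq\mathbf{QC}(B,B')$. * For $S\in\mathbf{CP}(A^*\otimes A',B^*\otimes B')$ and $\phi: A\otimes X\to A'\otimes X'$ let $S\cdot\phi: B\otimes X\to B'\otimes X'$ be obtained by bending the input $A$ of $\phi$ into an output $A^*$ with $\cup_A$, applying $S\otimes \mathrm{id}_{X'}$, and bending the output $B^*$ back into an input $B$ with $\cap_B$; that is $$S\cdot\phi=(\cap_B\otimes \mathrm{id}_{B'\otimes X'})\circ(\mathrm{id}_B\otimes S\otimes\mathrm{id}_{X'})\circ(\mathrm{id}_{B\otimes A^*}\otimes\phi)\circ(\mathrm{id}_B\otimes\cup_A\otimes\mathrm{id}_X).$$ A *quantum supermap* of type $K\to M$ is an $S\in\mathbf{CP}(A^*\otimes A',B^*\otimes B')$ such that $S\cdot\phi\in\mathrm{dExt}_{X,X'}(M)$ for all $X,X'$ and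 all $\phi\in\mathrm{dExt}_{X,X'}(K)$. * A *locally-applicable transformation* of type $K\to M$ on $\mathbf{QC}$ is a family of functions $T_{X,X'}:\mathrm{dExt}_{X,X'}(K)\to\mathrm{dExt}_{X,X'}(M)$, one for each pair of systems $X,X'$, such that for all systems $X,X',Y,Y',Z$, all channels $f\in\mathbf{QC}(Y,X\otimes Z)$ and $g\in\mathbf{QC}(X'\otimes Z,Y')$, and all $\phi\in\mathrm{dExt}_{X,X'}(K)$, $$T_{Y,Y'}\big((\mathrm{id}_{A'}\otimes g)\circ(\phi\otimes\mathrm{id}_Z)\circ(\mathrm{id}_A\otimes f)\big)=(\mathrm{id}_{B'}\otimes g)\circ(T_{X,X'}(\phi)\otimes\mathrm{id}_Z)\circ(\mathrm{id}_B\otimes f).$$ *Claim.* Suppose that $K$ and $M$ are normal and convex. Then quantum supermaps of type $K\to M$ are in one-to-one correspondence with locally-applicable transformations of type $K\to M$ on $\mathbf{QC}$. More precisely, $S\mapsto\big(\phi\mapsto S\cdot\phi\big)_{X,X'}$ is a bijection from the former to the latter. Moreover $\mathrm{SWAP}_{A,A'}\in\mathrm{dExt}_{A',A}(K)$, and the inverse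 bijection sends $T$ to the completely positive map $A^*\otimes A'\to B^*\otimes B'$ obtained from the channel $T_{A',A}(\mathrm{SWAP}_{A,A'}): B\otimes A'\to B'\otimes A$ by bending its input $B$ into an output $B^*$ with $\cup_B$ and its output $A$ into an input $A^*$ with $\cap_A$. -/

import Mathlib

open scoped ComplexOrder

namespace QuantumSupermaps

/-! ### Linear maps on operators, completely positive maps, channels

A system is a finite type `A`; it stands for the Hilbert space `ℂ^A`, with operators
`Matrix A A ℂ`. The tensor product of systems is `A × B`, the tensor unit is `Unit`. Since
`ℂ^A` comes with its basis, the dual system of `A` is again represented by `A`. -/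

/-- Linear maps from the operators on `ℂ^A` to the operators on `ℂ^B`. -/
abbrev SuperOp (A B : Type) : Type := Matrix A A ℂ →ₗ[ℂ] Matrix B B ℂ

/-- The block `(P (a, z) (a', w))_{a, a'}` of an operator of `ℂ^A ⊗ ℂ^Z`. -/
def blockR {A Z : Type} (z w : Z) : Matrix (A × Z) (A × Z) ℂ →ₗ[ℂ] Matrix A A ℂ where
  toFun P := Matrix.of fun a a' => P (a, z) (a', w)
  map_add' _ _ := rfl
  map_smul' _ _ := rfl

/-- The block `(P (z, a) (w, a'))_{a, a'}` of an operator of `ℂ^Z ⊗ ℂ^A`. -/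
def blockL {A Z : Type} (z w : Z) : Matrix (Z × A) (Z × A) ℂ →ₗ[ℂ] Matrix A A ℂ where
  toFun P := Matrix.of fun a a' => P (z, a) (w, a')
  map_add' _ _ := rfl
  map_smul' _ _ := rfl

/-- `f ⊗ id` on operators of `ℂ^A ⊗ ℂ^Z`: the map `f` is applied to every block. -/
def ampR {A B : Type} (f : SuperOp A B) (Z : Type) : SuperOp (A × Z) (B × Z) where
  toFun P := Matrix.of fun i j => f (blockR i.2 j.2 P) i.1 j.1
  map_add' P Q := by
    ext i j
    simp
  map_smul' c P := by
    ext i j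
    simp

/-- `id ⊗ g` on operators of `ℂ^Z ⊗ ℂ^A`: the map `g` is applied to every block. -/
def ampL {A B : Type} (Z : Type) (g : SuperOp A B) : SuperOp (Z × A) (Z × B) where
  toFun P := Matrix.of fun i j => g (blockL i.1 j.1 P) i.2 j.2
  map_add' P Q := by
    ext i j
    simp
  map_smul' c P := by
    ext i j
    simp

/-- The tensor product `f ⊗ g = (id ⊗ g) ∘ (f ⊗ id)`. -/
def tens {A B C D : Type} (f : SuperOp A B) (g : SuperOp C D) : SuperOp (A × C) (B × D) :=
  ampL B g ∘ₗ ampR f C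

/-- The structural isomorphism that relabels the basis along a bijection; associators, unitors
and swaps are of this form. -/
def relabel {A B : Type} (e : A ≃ B) : SuperOp A B :=
  (Matrix.reindexLinearEquiv ℂ ℂ e e).toLinearMap

def assoc (A B C : Type) : SuperOp ((A × B) × C) (A × (B × C)) :=
  relabel (Equiv.prodAssoc A B C)

def assocInv (A B C : Type) : SuperOp (A × (B × C)) ((A × B) × C) :=
  relabel (Equiv.prodAssoc A B C).symm

/-- The swap `A ⊗ B → B ⊗ A`. -/
def swap (A B : Type) : SuperOp (A × B) (B × A) :=
  relabel (Equiv.prodComm A B)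

def leftUnitor (A : Type) : SuperOp (Unit × A) A := relabel (Equiv.punitProd A)

def leftUnitorInv (A : Type) : SuperOp A (Unit × A) := relabel (Equiv.punitProd A).symm

def rightUnitor (A : Type) : SuperOp (A × Unit) A := relabel (Equiv.prodPUnit A)

def rightUnitorInv (A : Type) : SuperOp A (A × Unit) := relabel (Equiv.prodPUnit A).symm

/-- The (unnormalised) Bell state `I → A* ⊗ A`. -/
noncomputable def cup (A : Type) [Fintype A] : SuperOp Unit (A × A) :=
  open Classical in
  LinearMap.toSpanSingleton ℂ _
    (Matrix.of fun i j => if i.1 = i.2 ∧ j.1 = j.2 then (1 : ℂ) else 0) ∘ₗ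
    Matrix.traceLinearMap Unit ℂ ℂ

/-- The (unnormalised) Bell effect `A ⊗ A* → I`, `P ↦ ∑ a a', P (a, a) (a', a')`. -/
def cap (A : Type) [Fintype A] : SuperOp (A × A) Unit where
  toFun P := Matrix.of fun _ _ => ∑ a, ∑ a', P (a, a) (a', a')
  map_add' P Q := by
    ext i j
    simp [Finset.sum_add_distrib]
  map_smul' c P := by
    ext i j
    simp [Finset.mul_sum]

/-- Complete positivity: `f ⊗ id_Z` preserves positive semidefiniteness for every auxiliary
system `Z`. -/
def IsCP {A B : Type} (f : SuperOp A B) : Prop :=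
  ∀ (Z : Type) [Fintype Z] (P : Matrix (A × Z) (A × Z) ℂ),
    P.PosSemidef → (tens f (LinearMap.id : SuperOp Z Z) P).PosSemidef

/-- The completely positive maps `A → B`. -/
def CP (A B : Type) : Set (SuperOp A B) := {f | IsCP f}

/-- The quantum channels `A → B`: completely positive trace-preserving maps. -/
def QC (A B : Type) [Fintype A] [Fintype B] : Set (SuperOp A B) :=
  {f | IsCP f ∧ ∀ P, (f P).trace = P.trace}

/-! ### Dilation extensions and normal sets -/

/-- The map `A → A'` obtained from `Φ : A ⊗ X → A' ⊗ X'` by inserting a state `ρ : I → X`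
and an effect `σ : X' → I` into the auxiliary wires. -/
def reduce {A A' X X' : Type} (Φ : SuperOp (A × X) (A' × X')) (ρ : SuperOp Unit X)
    (σ : SuperOp X' Unit) : SuperOp A A' :=
  rightUnitor A' ∘ₗ tens LinearMap.id σ ∘ₗ Φ ∘ₗ tens LinearMap.id ρ ∘ₗ rightUnitorInv A

/-- The dilation extension of `K` by `X`, `X'`: all channels `A ⊗ X → A' ⊗ X'` that give a
member of `K` for every state on `X` and every effect on `X'` (both morphisms of channels). -/
def dExt {A A' : Type} [Fintype A] [Fintype A'] (X X' : Type) [Fintype X] [Fintype X']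
    (K : Set (SuperOp A A')) : Set (SuperOp (A × X) (A' × X')) :=
  {Φ | Φ ∈ QC (A × X) (A' × X') ∧
    ∀ ρ ∈ QC Unit X, ∀ σ ∈ QC X' Unit, reduce Φ ρ σ ∈ K}

/-- `K` contains all discard-and-prepare channels. -/
def IsNormal {A A' : Type} [Fintype A] [Fintype A'] (K : Set (SuperOp A A')) : Prop :=
  ∀ d ∈ QC A Unit, ∀ ρ ∈ QC Unit A', ρ ∘ₗ d ∈ K

/-- The circuit `(id ⊗ g) ∘ (φ ⊗ id_Z) ∘ (id ⊗ f)` of type `A ⊗ Y → A' ⊗ Y'`, which acts on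
the auxiliary wires of `φ : A ⊗ X → A' ⊗ X'` only. -/
def plug {A A' X X' Y Y' Z : Type} (f : SuperOp Y (X × Z)) (g : SuperOp (X' × Z) Y')
    (φ : SuperOp (A × X) (A' × X')) : SuperOp (A × Y) (A' × Y') :=
  tens LinearMap.id g ∘ₗ assoc A' X' Z ∘ₗ tens φ (LinearMap.id : SuperOp Z Z) ∘ₗ
    assocInv A X Z ∘ₗ tens LinearMap.id f

/-! ### Basic facts: channels are closed under circuits, dilation extensions under `plug` -/

theorem tens_id_right {A B : Type} (f : SuperOp A B) (Z : Type) :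
    tens f (LinearMap.id : SuperOp Z Z) = ampR f Z := rfl

theorem tens_id_left {A B : Type} (g : SuperOp A B) (Z : Type) :
    tens (LinearMap.id : SuperOp Z Z) g = ampL Z g := rfl

/-- On product operators, `f ⊗ g` is the product of `f` and `g`. -/
theorem tens_kronecker {A B C D : Type} (f : SuperOp A B) (g : SuperOp C D)
    (P : Matrix A A ℂ) (Q : Matrix C C ℂ) :
    tens f g (Matrix.kroneckerMap (· * ·) P Q) =
      Matrix.kroneckerMap (· * ·) (f P) (g Q) := by
  have h1 : ∀ c c' : C, blockR c c' (Matrix.kroneckerMap (· * ·) P Q) = Q c c' • P := by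
    intro c c'
    ext a a'
    exact mul_comm _ _
  ext i j
  have h2 : blockL i.1 j.1 (ampR f C (Matrix.kroneckerMap (· * ·) P Q)) =
      f P i.1 j.1 • Q := by
    ext c c'
    change f (blockR c c' (Matrix.kroneckerMap (· * ·) P Q)) i.1 j.1 = _
    rw [h1, f.map_smul]
    exact mul_comm _ _
  change g (blockL i.1 j.1 (ampR f C (Matrix.kroneckerMap (· * ·) P Q))) i.2 j.2 = _
  rw [h2, g.map_smul]
  rfl

theorem IsCP.comp {A B C : Type} {g : SuperOp B C} {f : SuperOp A B} (hg : IsCP g)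
    (hf : IsCP f) : IsCP (g ∘ₗ f) := by
  intro Z _ P hP
  have h : tens (g ∘ₗ f) (LinearMap.id : SuperOp Z Z) P =
      tens g LinearMap.id (tens f LinearMap.id P) := by
    ext i j
    rfl
  rw [h]
  exact hg Z _ (hf Z P hP)

theorem isCP_id (A : Type) : IsCP (LinearMap.id : SuperOp A A) := fun _ _ _ hP => hP

theorem isCP_relabel {A B : Type} (e : A ≃ B) : IsCP (relabel e) := fun Z _ _ hP =>
  hP.submatrix (fun i : B × Z => (e.symm i.1, i.2))

theorem isCP_ampR {A B : Type} {f : SuperOp A B} (hf : IsCP f) (X : Type) [Fintype X] :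
    IsCP (ampR f X) := fun Z _ _ hP =>
  (hf (X × Z) _ (hP.submatrix (fun i : A × (X × Z) => ((i.1, i.2.1), i.2.2)))).submatrix
    (fun i : (B × X) × Z => (i.1.1, (i.1.2, i.2)))

theorem isCP_ampL {A B : Type} {f : SuperOp A B} (hf : IsCP f) (X : Type) [Fintype X] :
    IsCP (ampL X f) := fun Z _ _ hP =>
  (hf (X × Z) _ (hP.submatrix (fun i : A × (X × Z) => ((i.2.1, i.1), i.2.2)))).submatrix
    (fun i : (X × B) × Z => (i.1.2, (i.1.1, i.2)))

theorem comp_mem_QC {A B C : Type} [Fintype A] [Fintype B] [Fintype C] {g : SuperOp B C}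
    {f : SuperOp A B} (hg : g ∈ QC B C) (hf : f ∈ QC A B) : g ∘ₗ f ∈ QC A C :=
  ⟨hg.1.comp hf.1, fun P => (hg.2 _).trans (hf.2 P)⟩

theorem relabel_mem_QC {A B : Type} [Fintype A] [Fintype B] (e : A ≃ B) :
    relabel e ∈ QC A B :=
  ⟨isCP_relabel e, fun P => Equiv.sum_comp e.symm (fun a => P a a)⟩

theorem ampR_mem_QC {A B : Type} [Fintype A] [Fintype B] {f : SuperOp A B}
    (hf : f ∈ QC A B) (X : Type) [Fintype X] : ampR f X ∈ QC (A × X) (B × X) := by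
  refine ⟨isCP_ampR hf.1 X, fun P => ?_⟩
  have h : ∀ x : X, ∑ b, f (blockR x x P) b b = ∑ a, P (a, x) (a, x) :=
    fun x => hf.2 (blockR x x P)
  calc (ampR f X P).trace
      = ∑ i : B × X, f (blockR i.2 i.2 P) i.1 i.1 := rfl
    _ = ∑ x, ∑ b, f (blockR x x P) b b := Fintype.sum_prod_type_right _
    _ = ∑ x, ∑ a, P (a, x) (a, x) := Finset.sum_congr rfl fun x _ => h x
    _ = P.trace := (Fintype.sum_prod_type_right (fun i : A × X => P i i)).symm

theorem ampL_mem_QC {A B : Type} [Fintype A] [Fintype B] {f : SuperOp A B}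
    (hf : f ∈ QC A B) (X : Type) [Fintype X] : ampL X f ∈ QC (X × A) (X × B) := by
  refine ⟨isCP_ampL hf.1 X, fun P => ?_⟩
  have h : ∀ x : X, ∑ b, f (blockL x x P) b b = ∑ a, P (x, a) (x, a) :=
    fun x => hf.2 (blockL x x P)
  calc (ampL X f P).trace
      = ∑ i : X × B, f (blockL i.1 i.1 P) i.2 i.2 := rfl
    _ = ∑ x, ∑ b, f (blockL x x P) b b := Fintype.sum_prod_type _
    _ = ∑ x, ∑ a, P (x, a) (x, a) := Finset.sum_congr rfl fun x _ => h x
    _ = P.trace := (Fintype.sum_prod_type (fun i : X × A => P i i)).symm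

theorem plug_mem_QC {A A' X X' Y Y' Z : Type} [Fintype A] [Fintype A'] [Fintype X]
    [Fintype X'] [Fintype Y] [Fintype Y'] [Fintype Z] {f : SuperOp Y (X × Z)}
    {g : SuperOp (X' × Z) Y'} {φ : SuperOp (A × X) (A' × X')} (hf : f ∈ QC Y (X × Z))
    (hg : g ∈ QC (X' × Z) Y') (hφ : φ ∈ QC (A × X) (A' × X')) :
    plug f g φ ∈ QC (A × Y) (A' × Y') :=
  comp_mem_QC (ampL_mem_QC hg A') <| comp_mem_QC (relabel_mem_QC _) <|
    comp_mem_QC (ampR_mem_QC hφ Z) <| comp_mem_QC (relabel_mem_QC _) (ampL_mem_QC hf A)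

/-- The partial trace `X ⊗ Z → X`. -/
def discardR (X Z : Type) [Fintype Z] : SuperOp (X × Z) X where
  toFun P := Matrix.of fun x x' => ∑ z, P (x, z) (x', z)
  map_add' P Q := by
    ext i j
    simp [Finset.sum_add_distrib]
  map_smul' c P := by
    ext i j
    simp [Finset.mul_sum]

theorem discardR_mem_QC (X Z : Type) [Fintype X] [Fintype Z] :
    discardR X Z ∈ QC (X × Z) X := by
  refine ⟨fun W _ P hP => ?_, fun P => (Fintype.sum_prod_type (fun i : X × Z => P i i)).symm⟩
  have h : tens (discardR X Z) (LinearMap.id : SuperOp W W) P =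
      ∑ z : Z, P.submatrix (fun i : X × W => ((i.1, z), i.2)) (fun i => ((i.1, z), i.2)) := by
    ext i j
    rw [Matrix.sum_apply]
    rfl
  rw [h]
  exact Matrix.posSemidef_sum _ fun z _ => hP.submatrix _

/-- The unique effect `X → I` in the category of channels. -/
def discard (X : Type) [Fintype X] : SuperOp X Unit := discardR Unit X ∘ₗ leftUnitorInv X

theorem discard_mem_QC (X : Type) [Fintype X] : discard X ∈ QC X Unit :=
  comp_mem_QC (discardR_mem_QC Unit X) (relabel_mem_QC _)

theorem effect_apply {X : Type} [Fintype X] {σ : SuperOp X Unit} (hσ : σ ∈ QC X Unit)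
    (P : Matrix X X ℂ) (i j : Unit) : σ P i j = ∑ x, P x x := by
  have h : ∑ u : Unit, σ P u u = ∑ x, P x x := hσ.2 P
  simpa using h

theorem reduce_apply {A A' X X' : Type} [Fintype X'] (Φ : SuperOp (A × X) (A' × X'))
    (ρ : SuperOp Unit X) {σ : SuperOp X' Unit} (hσ : σ ∈ QC X' Unit) (P : Matrix A A ℂ)
    (i j : A') : reduce Φ ρ σ P i j =
      ∑ x, Φ (tens LinearMap.id ρ (rightUnitorInv A P)) (i, x) (j, x) :=
  effect_apply hσ (blockL i j (Φ (tens LinearMap.id ρ (rightUnitorInv A P)))) _ _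

/-- A dilation extension is stable under circuits on the auxiliary wires. -/
theorem plug_mem_dExt {A A' X X' Y Y' Z : Type} [Fintype A] [Fintype A'] [Fintype X]
    [Fintype X'] [Fintype Y] [Fintype Y'] [Fintype Z] {K : Set (SuperOp A A')}
    {f : SuperOp Y (X × Z)} {g : SuperOp (X' × Z) Y'} {φ : SuperOp (A × X) (A' × X')}
    (hf : f ∈ QC Y (X × Z)) (hg : g ∈ QC (X' × Z) Y') (hφ : φ ∈ dExt X X' K) :
    plug f g φ ∈ dExt Y Y' K := by
  refine ⟨plug_mem_QC hf hg hφ.1, fun ρ hρ σ hσ => ?_⟩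
  have key : reduce (plug f g φ) ρ σ =
      reduce φ (discardR X Z ∘ₗ f ∘ₗ ρ) (discard X') := by
    refine LinearMap.ext fun P => ?_
    ext i j
    rw [reduce_apply _ _ hσ, reduce_apply _ _ (discard_mem_QC X')]
    let Q : Matrix ((A × X) × Z) ((A × X) × Z) ℂ :=
      assocInv A X Z (tens LinearMap.id (f ∘ₗ ρ) (rightUnitorInv A P))
    have h1 : ∑ y, plug f g φ (tens LinearMap.id ρ (rightUnitorInv A P)) (i, y) (j, y) =
        ∑ w : X' × Z, φ (blockR w.2 w.2 Q) (i, w.1) (j, w.1) :=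
      hg.2 (blockL i j (assoc A' X' Z (tens φ LinearMap.id Q)))
    have h2 : tens LinearMap.id (discardR X Z ∘ₗ f ∘ₗ ρ) (rightUnitorInv A P) =
        ∑ z : Z, blockR z z Q := by
      ext a b
      rw [Matrix.sum_apply]
      rfl
    rw [h1, h2, map_sum, Fintype.sum_prod_type]
    refine Finset.sum_congr rfl fun x _ => ?_
    rw [Matrix.sum_apply]
  rw [key]
  exact hφ.2 _ (comp_mem_QC (discardR_mem_QC X Z) (comp_mem_QC hf hρ)) _ (discard_mem_QC X')

/-! ### Quantum supermaps and locally-applicable transformations -/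

/-- Bending the input `B` of `χ : B ⊗ X → B' ⊗ X'` into an output:
`X → (B* ⊗ B') ⊗ X'`. -/
noncomputable def bendUp {B B' X X' : Type} [Fintype B] (χ : SuperOp (B × X) (B' × X')) :
    SuperOp X ((B × B') × X') :=
  assocInv B B' X' ∘ₗ tens LinearMap.id χ ∘ₗ assoc B B X ∘ₗ tens (cup B) LinearMap.id ∘ₗ
    leftUnitorInv X

/-- Bending the output `B*` of `ω : X → (B* ⊗ B') ⊗ X'` into an input:
`B ⊗ X → B' ⊗ X'`. -/
def bendDown {B B' X X' : Type} [Fintype B] (ω : SuperOp X ((B × B') × X')) :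
    SuperOp (B × X) (B' × X') :=
  leftUnitor (B' × X') ∘ₗ tens (cap B) LinearMap.id ∘ₗ assocInv B B (B' × X') ∘ₗ
    tens LinearMap.id (assoc B B' X' ∘ₗ ω)

/-- The action of `S : A* ⊗ A' → B* ⊗ B'` on `φ : A ⊗ X → A' ⊗ X'`, with the wires
`X`, `X'` untouched. -/
noncomputable def act {A A' B B' X X' : Type} [Fintype A] [Fintype B]
    (S : SuperOp (A × A') (B × B')) (φ : SuperOp (A × X) (A' × X')) :
    SuperOp (B × X) (B' × X') :=
  bendDown (tens S LinearMap.id ∘ₗ bendUp φ)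

/-- The map `A* ⊗ A' → B* ⊗ B'` obtained from `χ : B ⊗ A' → B' ⊗ A` by bending the input
`B` with a cup and the output `A` with a cap. -/
noncomputable def unbend {A A' B B' : Type} [Fintype A] [Fintype B]
    (χ : SuperOp (B × A') (B' × A)) : SuperOp (A × A') (B × B') :=
  rightUnitor (B × B') ∘ₗ tens LinearMap.id (cap A) ∘ₗ assoc (B × B') A A ∘ₗ
    tens (bendUp χ) LinearMap.id ∘ₗ swap A A'

/-- Quantum supermaps of type `K → M` (for the dilation extensions of `K` and `M`):
completely positive maps `A* ⊗ A' → B* ⊗ B'` whose action maps every extension of `K` to an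
extension of `M`. -/
structure QuantumSupermap {A A' B B' : Type} [Fintype A] [Fintype A'] [Fintype B]
    [Fintype B'] (K : Set (SuperOp A A')) (M : Set (SuperOp B B')) where
  toMap : SuperOp (A × A') (B × B')
  cp : toMap ∈ CP (A × A') (B × B')
  act_mem : ∀ (X X' : Type) [Fintype X] [Fintype X'], ∀ φ ∈ dExt X X' K,
    act toMap φ ∈ dExt X X' M

/-- Locally-applicable transformations of type `K → M` on the category of quantum channels
(for the dilation extensions of `K` and `M`): families of functions that commute with all
circuits on the auxiliary wires. -/
structure LocallyApplicable {A A' B B' : Type} [Fintype A] [Fintype A'] [Fintype B]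
    [Fintype B'] (K : Set (SuperOp A A')) (M : Set (SuperOp B B')) where
  app : ∀ (X X' : Type) [Fintype X] [Fintype X'], dExt X X' K → dExt X X' M
  local_app : ∀ (X X' Y Y' Z : Type) [Fintype X] [Fintype X'] [Fintype Y] [Fintype Y']
    [Fintype Z] (f : SuperOp Y (X × Z)) (g : SuperOp (X' × Z) Y')
    (hf : f ∈ QC Y (X × Z)) (hg : g ∈ QC (X' × Z) Y') (φ : dExt X X' K),
    (app Y Y' ⟨plug f g φ.1, plug_mem_dExt hf hg φ.2⟩ : SuperOp (B × Y) (B' × Y')) =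
      plug f g (app X X' φ).1

end QuantumSupermaps

open QuantumSupermaps

/-!
A map `S` acts on `φ` through wire bending alone, so its action commutes with circuits on the
auxiliary wires (`act_plug`), and `S` is recovered from its action on the swap by the snake
equations (`unbend_act_swap`). The substance is the converse: a locally-applicable transformation
`T` is the action of the completely positive map `S` obtained by bending `T (swap)`
(`LocallyApplicable.act_unbend_app_swap`).

By teleportation, every `φ : A ⊗ X → A' ⊗ X'` arises from the swap by a circuit on the auxiliary
wires, up to a postselection: feed the normalised Choi channel of `φ` into the swap and project
two copies of `A` onto the maximally entangled state, which succeeds with probability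
`p = 1 / |A|²`. The same circuit around `T (swap)` gives `p • (S · φ)` (`plug_choi_bell`), but the
postselection is not a channel, so `T` need not commute with it a priori. It does because `T`
preserves convex combinations (`LocallyApplicable.app_mix`): by convexity of `K`, a channel
that applies `φ₀` or `φ₁` according to a control bit is again a dilation extension
(`controlled_mem_dExt`), and a random control bit, which is a circuit on the auxiliary wires,
produces the mixture.

Now let `Φ` be the circuit around the swap that records success of the projection as `false` and
failure as `true`, and `Φ'` the one that makes no test and always records `true`. Then
`Φ + p • (φ ⊗ |true⟩⟨true|) = Φ' + p • (φ ⊗ |false⟩⟨false|)`, since `Φ` arises from `Φ'` by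
relabelling the part `p • φ`, in which the projection succeeds, from `true` to `false`. After
division by `1 + p`, both sides are convex combinations of dilation extensions of `K`. Applying `T`
and reading off the block of the register state `false` gives `p • (S · φ) = p • T φ`. Normality of
`K` serves to make the swap a dilation extension of `K`.

The teleportation argument needs `A` to be nonempty; when `A` is empty, `T φ` and
`S · φ` both vanish, because `φ ⊗ |false⟩⟨false|` and `φ ⊗ |true⟩⟨true|` are both zero.
-/

open scoped ComplexOrder

namespace QuantumSupermaps

/-! ### Matrix units tensored with operators -/

/-- The operator `|b⟩⟨c| ⊗ Q` of `ℂ^B ⊗ ℂ^X`. These operators span, and every wire-bending map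
has a simple value on them. -/
noncomputable def unitTensor {B X : Type} (b c : B) :
    Matrix X X ℂ →ₗ[ℂ] Matrix (B × X) (B × X) ℂ :=
  open Classical in
  { toFun := fun Q => Matrix.kroneckerMap (· * ·) (Matrix.single b c (1 : ℂ)) Q
    map_add' := fun P Q => by
      ext i j
      simp [mul_add]
    map_smul' := fun r Q => by
      ext i j
      simp [mul_left_comm] }

open Classical in
theorem unitTensor_apply {B X : Type} (b c : B) (Q : Matrix X X ℂ) (p q : B × X) :
    unitTensor b c Q p q = if b = p.1 ∧ c = q.1 then Q p.2 q.2 else 0 := by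
  change Matrix.single b c (1 : ℂ) p.1 q.1 * Q p.2 q.2 = _
  rw [Matrix.single_apply]
  split_ifs <;> simp

open Classical in
theorem blockL_unitTensor {B X : Type} (b c i j : B) (Q : Matrix X X ℂ) :
    blockL i j (unitTensor b c Q) = if b = i ∧ c = j then Q else 0 := by
  ext x y
  change unitTensor b c Q (i, x) (j, y) = _
  rw [unitTensor_apply]
  split_ifs <;> rfl

theorem sum_unitTensor_blockL {B X : Type} [Fintype B] (P : Matrix (B × X) (B × X) ℂ) :
    ∑ b, ∑ c, unitTensor b c (blockL b c P) = P := by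
  classical
  ext ⟨i, x⟩ ⟨j, y⟩
  simp only [Matrix.sum_apply, unitTensor_apply]
  rw [Finset.sum_eq_single i, Finset.sum_eq_single j]
  · rw [if_pos ⟨rfl, rfl⟩]
    rfl
  · intro c _ hc
    rw [if_neg fun h => hc h.2]
  · simp
  · intro b _ hb
    exact Finset.sum_eq_zero fun c _ => if_neg fun h => hb h.1
  · simp

theorem superOp_ext_unitTensor {B X C : Type} [Finite B] {f g : SuperOp (B × X) C}
    (h : ∀ b c Q, f (unitTensor b c Q) = g (unitTensor b c Q)) : f = g := by
  cases nonempty_fintype B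
  refine LinearMap.ext fun P => ?_
  rw [← sum_unitTensor_blockL P]
  simp only [map_sum, h]

/-- Maps on different tensor factors commute. -/
theorem ampL_ampR_comm {A B C D : Type} [Finite A] (f : SuperOp A B) (g : SuperOp C D)
    (P : Matrix (A × C) (A × C) ℂ) :
    ampL B g (ampR f C P) = ampR f D (ampL A g P) := by
  classical
  suffices h : ampL B g ∘ₗ ampR f C = ampR f D ∘ₗ ampL A g from LinearMap.congr_fun h P
  refine superOp_ext_unitTensor fun b c Q => ?_
  have h1 : ampL A g (unitTensor b c Q) = unitTensor b c (g Q) :=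
    tens_kronecker LinearMap.id g (Matrix.single b c (1 : ℂ)) Q
  have h2 : ampL B g (ampR f C (unitTensor b c Q)) =
      Matrix.kroneckerMap (· * ·) (f (Matrix.single b c 1)) (g Q) :=
    tens_kronecker f g (Matrix.single b c (1 : ℂ)) Q
  have h3 : ampR f D (unitTensor b c (g Q)) =
      Matrix.kroneckerMap (· * ·) (f (Matrix.single b c 1)) (g Q) :=
    tens_kronecker f (LinearMap.id : SuperOp D D) (Matrix.single b c (1 : ℂ)) (g Q)
  rw [LinearMap.comp_apply, LinearMap.comp_apply, h1, h2, h3]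

/-! ### Entries of bent maps -/

theorem blockL_ampR_cup {B X : Type} [Fintype B] (Q : Matrix X X ℂ) (b c : B) :
    blockL b c (assoc B B X (ampR (cup B) X (leftUnitorInv X Q))) = unitTensor b c Q := by
  classical
  ext ⟨i, x⟩ ⟨j, y⟩
  rw [unitTensor_apply]
  change (∑ _ : Unit, Q x y) * (if b = i ∧ c = j then (1 : ℂ) else 0) = _
  simp

theorem bendUp_apply {B B' X X' : Type} [Fintype B] (χ : SuperOp (B × X) (B' × X'))
    (Q : Matrix X X ℂ) (p q : (B × B') × X') :
    bendUp χ Q p q = χ (unitTensor p.1.1 q.1.1 Q) (p.1.2, p.2) (q.1.2, q.2) := by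
  rw [← blockL_ampR_cup]
  rfl

theorem bendDown_apply {B B' X X' : Type} [Fintype B] (ω : SuperOp X ((B × B') × X'))
    (P : Matrix (B × X) (B × X) ℂ) (p q : B' × X') :
    bendDown ω P p q = ∑ b, ∑ c, ω (blockL b c P) ((b, p.1), p.2) ((c, q.1), q.2) := rfl

theorem bendDown_unitTensor {B B' X X' : Type} [Fintype B] (ω : SuperOp X ((B × B') × X'))
    (b c : B) (Q : Matrix X X ℂ) (p q : B' × X') :
    bendDown ω (unitTensor b c Q) p q = ω Q ((b, p.1), p.2) ((c, q.1), q.2) := by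
  classical
  rw [bendDown_apply, Finset.sum_eq_single b, Finset.sum_eq_single c]
  · rw [blockL_unitTensor, if_pos ⟨rfl, rfl⟩]
  · intro j _ hj
    rw [blockL_unitTensor, if_neg fun h => hj h.2.symm, map_zero]
    rfl
  · simp
  · intro i _ hi
    refine Finset.sum_eq_zero fun j _ => ?_
    rw [blockL_unitTensor, if_neg fun h => hi h.1.symm, map_zero]
    rfl
  · simp

theorem act_unitTensor {A A' B B' X X' : Type} [Fintype A] [Fintype B]
    (S : SuperOp (A × A') (B × B')) (φ : SuperOp (A × X) (A' × X')) (b c : B)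
    (Q : Matrix X X ℂ) (p q : B' × X') :
    act S φ (unitTensor b c Q) p q =
      S (blockR p.2 q.2 (bendUp φ Q)) (b, p.1) (c, q.1) :=
  bendDown_unitTensor _ _ _ _ _ _

theorem unbend_apply {A A' B B' : Type} [Fintype A] [Fintype B]
    (χ : SuperOp (B × A') (B' × A)) (R : Matrix (A × A') (A × A') ℂ) (p q : B × B') :
    unbend χ R p q =
      ∑ a, ∑ e, χ (unitTensor p.1 q.1 (blockL a e R)) (p.2, a) (q.2, e) := by
  have h : unbend χ R p q = ∑ a, ∑ e, bendUp χ (blockL a e R) (p, a) (q, e) := rfl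
  simp only [h, bendUp_apply]

open Classical in
theorem swap_unitTensor {A A' : Type} (a e : A) (Q : Matrix A' A' ℂ) (p q : A' × A) :
    swap A A' (unitTensor a e Q) p q = if a = p.2 ∧ e = q.2 then Q p.1 q.1 else 0 :=
  unitTensor_apply a e Q (p.2, p.1) (q.2, q.1)

theorem blockR_bendUp_swap {A A' : Type} [Fintype A] (Q : Matrix A' A' ℂ) (a e : A) :
    blockR a e (bendUp (swap A A') Q) = unitTensor a e Q := by
  classical
  ext p q
  change bendUp (swap A A') Q (p, a) (q, e) = _
  rw [bendUp_apply, swap_unitTensor, unitTensor_apply]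
  simp only [eq_comm]

/-- A map is recovered from its action on the swap. -/
theorem unbend_act_swap {A A' B B' : Type} [Fintype A] [Fintype B]
    (S : SuperOp (A × A') (B × B')) : unbend (act S (swap A A')) = S := by
  refine LinearMap.ext fun R => ?_
  ext p q
  conv_rhs => rw [← sum_unitTensor_blockL R]
  simp only [unbend_apply, act_unitTensor, blockR_bendUp_swap, map_sum, Matrix.sum_apply]

theorem act_id {A A' X X' : Type} [Fintype A] (φ : SuperOp (A × X) (A' × X')) :
    act (LinearMap.id : SuperOp (A × A') (A × A')) φ = φ := by
  refine superOp_ext_unitTensor fun b c Q => ?_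
  ext p q
  rw [act_unitTensor]
  exact bendUp_apply φ Q _ _

theorem act_unbend_swap {A A' X X' : Type} [Fintype A] (φ : SuperOp (A × X) (A' × X')) :
    act (unbend (swap A A')) φ = φ := by
  have h : act (LinearMap.id : SuperOp (A × A') (A × A')) (swap A A') = swap A A' := act_id _
  conv_lhs => rw [← h, unbend_act_swap, act_id]

/-! ### Circuits on the auxiliary wires -/

theorem plug_apply {A A' X X' Y Y' Z : Type} (f : SuperOp Y (X × Z)) (g : SuperOp (X' × Z) Y')
    (φ : SuperOp (A × X) (A' × X')) (P : Matrix (A × Y) (A × Y) ℂ) (p q : A' × Y') :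
    plug f g φ P p q = g (Matrix.of fun i j : X' × Z =>
      φ (Matrix.of fun k l : A × X => f (blockL k.1 l.1 P) (k.2, i.2) (l.2, j.2))
        (p.1, i.1) (q.1, j.1)) p.2 q.2 := rfl

theorem plug_unitTensor {A A' X X' Y Y' Z : Type} (f : SuperOp Y (X × Z))
    (g : SuperOp (X' × Z) Y') (φ : SuperOp (A × X) (A' × X')) (a e : A) (Q : Matrix Y Y ℂ)
    (p q : A' × Y') :
    plug f g φ (unitTensor a e Q) p q = g (Matrix.of fun i j : X' × Z =>
      φ (unitTensor a e (blockR i.2 j.2 (f Q))) (p.1, i.1) (q.1, j.1)) p.2 q.2 := by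
  classical
  rw [plug_apply]
  refine congrFun (congrFun (congrArg g ?_) _) _
  ext i j
  refine congrFun (congrFun (congrArg φ ?_) _) _
  ext k l
  rw [unitTensor_apply, Matrix.of_apply, blockL_unitTensor]
  split_ifs
  · rfl
  · rw [map_zero]
    rfl

/-- The action of a map commutes with circuits on the auxiliary wires. -/
theorem act_plug {A A' B B' X X' Y Y' Z : Type} [Fintype A] [Finite A'] [Fintype B]
    (S : SuperOp (A × A') (B × B')) (f : SuperOp Y (X × Z)) (g : SuperOp (X' × Z) Y')
    (φ : SuperOp (A × X) (A' × X')) : act S (plug f g φ) = plug f g (act S φ) := by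
  refine superOp_ext_unitTensor fun b c Q => ?_
  ext p q
  rw [act_unitTensor, plug_unitTensor]
  simp only [act_unitTensor]
  let R : Matrix ((A × A') × (X' × Z)) ((A × A') × (X' × Z)) ℂ := Matrix.of fun i j =>
    bendUp φ (blockR i.2.2 j.2.2 (f Q)) (i.1, i.2.1) (j.1, j.2.1)
  have h1 : blockR p.2 q.2 (bendUp (plug f g φ) Q) = blockR p.2 q.2 (ampL (A × A') g R) := by
    ext i j
    change bendUp (plug f g φ) Q (i, p.2) (j, q.2) = g (blockL i j R) p.2 q.2
    rw [bendUp_apply, plug_unitTensor]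
    refine congrFun (congrFun (congrArg g ?_) _) _
    ext k l
    exact (bendUp_apply φ (blockR k.2 l.2 (f Q)) (i, k.1) (j, l.1)).symm
  rw [h1]
  exact (congrFun (congrFun (ampL_ampR_comm S g R) ((b, p.1), p.2)) ((c, q.1), q.2)).symm

/-! ### Complete positivity of the building blocks -/

theorem IsCP.add {A B : Type} {f g : SuperOp A B} (hf : IsCP f) (hg : IsCP g) :
    IsCP (f + g) := fun Z _ P hP => (hf Z P hP).add (hg Z P hP)

theorem IsCP.smul {A B : Type} {f : SuperOp A B} (hf : IsCP f) {r : ℝ} (hr : 0 ≤ r) :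
    IsCP (r • f) := fun Z _ P hP => (hf Z P hP).smul hr

/-- A map of the form `P ↦ ∑ k, V k * P * (V k)ᴴ` is completely positive. -/
theorem isCP_of_kraus {A B κ : Type} [Fintype A] [Finite B] [Fintype κ] (V : κ → Matrix B A ℂ)
    {f : SuperOp A B} (hf : ∀ P, f P = ∑ k, V k * P * (V k).conjTranspose) : IsCP f := by
  classical
  intro Z _ P hP
  have h : tens f (LinearMap.id : SuperOp Z Z) P = ∑ k,
      Matrix.kroneckerMap (· * ·) (V k) (1 : Matrix Z Z ℂ) * P *
        (Matrix.kroneckerMap (· * ·) (V k) (1 : Matrix Z Z ℂ)).conjTranspose := by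
    ext ⟨b, z⟩ ⟨c, w⟩
    change f (blockR z w P) b c = _
    rw [hf, Matrix.sum_apply, Matrix.sum_apply]
    refine Finset.sum_congr rfl fun k _ => ?_
    simp [Matrix.mul_apply, Fintype.sum_prod_type, Matrix.one_apply, apply_ite]
    rfl
  rw [h]
  exact Matrix.posSemidef_sum _ fun k _ => hP.mul_mul_conjTranspose_same _

theorem isCP_cup (A : Type) [Fintype A] : IsCP (cup A) := by
  classical
  refine isCP_of_kraus (κ := Unit)
    (fun _ => Matrix.of fun i _ => if i.1 = i.2 then (1 : ℂ) else 0) fun P => ?_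
  ext i j
  change P.trace * (if i.1 = i.2 ∧ j.1 = j.2 then (1 : ℂ) else 0) = _
  by_cases hi : i.1 = i.2 <;> by_cases hj : j.1 = j.2 <;>
    simp [Matrix.mul_apply, Matrix.trace, hi, hj]

theorem isCP_cap (A : Type) [Fintype A] : IsCP (cap A) := by
  classical
  refine isCP_of_kraus (κ := Unit)
    (fun _ => Matrix.of fun _ i => if i.1 = i.2 then (1 : ℂ) else 0) fun P => ?_
  ext i j
  change ∑ a, ∑ a', P (a, a) (a', a') = _
  rw [Finset.sum_comm]
  simp [Matrix.mul_apply, Fintype.sum_prod_type, apply_ite]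

theorem isCP_bendUp {B B' X X' : Type} [Fintype B] [Fintype X] [Fintype X']
    {χ : SuperOp (B × X) (B' × X')} (hχ : IsCP χ) : IsCP (bendUp χ) :=
  (isCP_relabel _).comp <| (isCP_ampL hχ B).comp <| (isCP_relabel _).comp <|
    (isCP_ampR (isCP_cup B) X).comp (isCP_relabel _)

theorem isCP_unbend {A A' B B' : Type} [Fintype A] [Fintype A'] [Fintype B] [Fintype B']
    {χ : SuperOp (B × A') (B' × A)} (hχ : IsCP χ) : IsCP (unbend χ) :=
  (isCP_relabel _).comp <| (isCP_ampL (isCP_cap A) (B × B')).comp <| (isCP_relabel _).comp <|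
    (isCP_ampR (isCP_bendUp hχ) A).comp (isCP_relabel _)

theorem isCP_blockR {A Z : Type} (z : Z) : IsCP (blockR z z : SuperOp (A × Z) A) :=
  fun W _ _ hP => hP.submatrix fun i : A × W => ((i.1, z), i.2)

/-- Appending a classical register in the basis state `i`: the map `P ↦ P ⊗ |i⟩⟨i|`. -/
noncomputable def flag (X : Type) {C : Type} (i : C) : SuperOp X (X × C) :=
  open Classical in
  { toFun := fun P => Matrix.kroneckerMap (· * ·) P (Matrix.single i i (1 : ℂ))
    map_add' := fun P Q => by
      ext i j
      simp [add_mul]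
    map_smul' := fun r Q => by
      ext i j
      simp [mul_assoc] }

open Classical in
theorem flag_apply {X C : Type} (i : C) (P : Matrix X X ℂ) (p q : X × C) :
    flag X i P p q = if i = p.2 ∧ i = q.2 then P p.1 q.1 else 0 := by
  change P p.1 q.1 * Matrix.single i i (1 : ℂ) p.2 q.2 = _
  rw [Matrix.single_apply]
  split_ifs <;> simp

theorem blockR_comp_flag_self {X C : Type} (i : C) :
    blockR i i ∘ₗ flag X i = LinearMap.id := by
  refine LinearMap.ext fun P => ?_
  ext x y
  exact (flag_apply i P (x, i) (y, i)).trans (if_pos ⟨rfl, rfl⟩)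

theorem blockR_comp_flag_of_ne {X C : Type} {i j : C} (h : i ≠ j) :
    blockR j j ∘ₗ flag X i = 0 := by
  refine LinearMap.ext fun P => ?_
  ext x y
  exact (flag_apply i P (x, j) (y, j)).trans (if_neg fun h' => h h'.1)

theorem flag_mem_QC (X : Type) {C : Type} [Fintype X] [Fintype C] (i : C) :
    flag X i ∈ QC X (X × C) := by
  classical
  refine ⟨isCP_of_kraus (κ := Unit)
    (fun _ => Matrix.of fun p x => if i = p.2 then (1 : Matrix X X ℂ) p.1 x else 0)
    fun P => ?_, fun P => ?_⟩
  · ext ⟨x, j⟩ ⟨y, k⟩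
    rw [flag_apply]
    by_cases hj : i = j <;> by_cases hk : i = k <;>
      simp [Matrix.mul_apply, Matrix.one_apply, hj, hk, apply_ite (starRingEnd ℂ)]
  · simp only [Matrix.trace, Matrix.diag, flag_apply, Fintype.sum_prod_type]
    simp

/-- The map `(Tr (N ·)) ⊗ id` on operators of `ℂ^U ⊗ ℂ^X`. -/
def effect {U : Type} [Fintype U] (N : Matrix U U ℂ) (X : Type) : SuperOp (U × X) X where
  toFun P := Matrix.of fun x y => ∑ u, ∑ v, N v u * P (u, x) (v, y)
  map_add' P Q := by
    ext x y
    simp [mul_add, Finset.sum_add_distrib]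
  map_smul' r P := by
    ext x y
    simp [Finset.mul_sum, mul_left_comm]

theorem effect_add {U X : Type} [Fintype U] (N N' : Matrix U U ℂ) :
    effect (N + N') X = effect N X + effect N' X := by
  refine LinearMap.ext fun P => ?_
  ext x y
  simp [effect, add_mul, Finset.sum_add_distrib]

theorem isCP_effect {U : Type} [Fintype U] (L : Matrix U U ℂ) (X : Type) [Fintype X] :
    IsCP (effect (L.conjTranspose * L) X) := by
  classical
  refine isCP_of_kraus (κ := U)
    (fun k => Matrix.of fun x p => L k p.1 * if x = p.2 then (1 : ℂ) else 0) fun P => ?_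
  ext x y
  change ∑ u, ∑ v, (L.conjTranspose * L) v u * P (u, x) (v, y) = _
  simp only [Matrix.sum_apply, Matrix.mul_apply, Matrix.conjTranspose_apply,
    Fintype.sum_prod_type, Matrix.of_apply, apply_ite star, star_zero,
    mul_ite, ite_mul, mul_one, mul_zero, zero_mul, Finset.sum_ite_eq, Finset.mem_univ, if_true,
    Finset.sum_mul]
  rw [Finset.sum_comm, Finset.sum_congr rfl fun v _ => Finset.sum_comm, Finset.sum_comm]
  refine Finset.sum_congr rfl fun k _ => Finset.sum_congr rfl fun v _ =>
    Finset.sum_congr rfl fun u _ => ?_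
  ring

theorem trace_effect_one {U X : Type} [Fintype U] [DecidableEq U] [Fintype X]
    (P : Matrix (U × X) (U × X) ℂ) : (effect 1 X P).trace = P.trace := by
  change ∑ x, ∑ u, ∑ v, (1 : Matrix U U ℂ) v u * P (u, x) (v, x) = ∑ p, P p p
  simp [Matrix.one_apply, Fintype.sum_prod_type_right]

/-- The two-outcome measurement with effects `L₀ᴴ L₀` and `L₁ᴴ L₁` on the first tensor factor,
whose outcome is recorded in a classical register. -/
theorem measure_mem_QC {U X : Type} [Fintype U] [DecidableEq U] [Fintype X]
    {L₀ L₁ : Matrix U U ℂ}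
    (h : L₀.conjTranspose * L₀ + L₁.conjTranspose * L₁ = 1) :
    flag X false ∘ₗ effect (L₀.conjTranspose * L₀) X +
      flag X true ∘ₗ effect (L₁.conjTranspose * L₁) X ∈ QC (U × X) (X × Bool) := by
  refine ⟨((flag_mem_QC X false).1.comp (isCP_effect L₀ X)).add
    ((flag_mem_QC X true).1.comp (isCP_effect L₁ X)), fun P => ?_⟩
  rw [LinearMap.add_apply, Matrix.trace_add, LinearMap.comp_apply, LinearMap.comp_apply,
    (flag_mem_QC X false).2, (flag_mem_QC X true).2, ← Matrix.trace_add, ← LinearMap.add_apply,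
    ← effect_add, h, trace_effect_one]

/-! ### Convexity of dilation extensions -/

/-- A completely positive map `I → X` is a nonnegative multiple of a state, provided that there
is a state at all. -/
theorem exists_eq_smul_state {X : Type} [Fintype X] {τ ρ₀ : SuperOp Unit X} (hτ : IsCP τ)
    (hρ₀ : ρ₀ ∈ QC Unit X) :
    ∃ w : ℝ, 0 ≤ w ∧ (τ 1).trace = w ∧ ∃ ρ ∈ QC Unit X, τ = w • ρ := by
  have hunit : ∀ P : Matrix Unit Unit ℂ, P = P.trace • (1 : Matrix Unit Unit ℂ) := by
    intro P
    ext i j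
    simp [Matrix.trace]
  have hpos : (τ 1).PosSemidef := by
    have h2 := (hτ Unit 1 Matrix.PosSemidef.one).submatrix fun x : X => (x, ())
    have h3 : blockR () () (1 : Matrix (Unit × Unit) (Unit × Unit) ℂ) = 1 := by
      ext i j
      change (1 : Matrix (Unit × Unit) (Unit × Unit) ℂ) (i, ()) (j, ()) = _
      simp
    rw [← h3]
    exact h2
  obtain ⟨w, hw, hwt⟩ : ∃ w : ℝ, 0 ≤ w ∧ (τ 1).trace = w :=
    ⟨(τ 1).trace.re, (Complex.le_def.1 hpos.trace_nonneg).1,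
      Complex.ext rfl (Complex.le_def.1 hpos.trace_nonneg).2.symm⟩
  refine ⟨w, hw, hwt, ?_⟩
  rcases hw.eq_or_lt with rfl | hw'
  · refine ⟨ρ₀, hρ₀, LinearMap.ext fun P => ?_⟩
    rw [hunit P, map_smul, (hpos.trace_eq_zero_iff).1 (by simpa using hwt)]
    simp
  · refine ⟨w⁻¹ • τ, ⟨hτ.smul (inv_nonneg.2 hw), fun P => ?_⟩, (smul_inv_smul₀ hw'.ne' τ).symm⟩
    rw [hunit P, map_smul, Matrix.trace_smul, LinearMap.smul_apply, Matrix.trace_smul, hwt]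
    have : (w : ℂ) ≠ 0 := by exact_mod_cast hw'.ne'
    simp [Matrix.trace_smul, this]

theorem reduce_add {A A' X X' : Type} (Φ Ψ : SuperOp (A × X) (A' × X')) (ρ : SuperOp Unit X)
    (σ : SuperOp X' Unit) : reduce (Φ + Ψ) ρ σ = reduce Φ ρ σ + reduce Ψ ρ σ := by
  simp only [reduce, LinearMap.add_comp, LinearMap.comp_add]

theorem reduce_smul {A A' X X' : Type} [Fintype X'] (Φ : SuperOp (A × X) (A' × X')) (w : ℝ)
    (ρ : SuperOp Unit X) {σ : SuperOp X' Unit} (hσ : σ ∈ QC X' Unit) :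
    reduce Φ (w • ρ) σ = w • reduce Φ ρ σ := by
  refine LinearMap.ext fun P => ?_
  ext i j
  have h : tens LinearMap.id (w • ρ) (rightUnitorInv A P) =
      (w : ℂ) • tens LinearMap.id ρ (rightUnitorInv A P) := by
    ext p q
    exact Complex.real_smul
  rw [reduce_apply _ _ hσ, h, map_smul, LinearMap.smul_apply, Matrix.smul_apply,
    reduce_apply _ _ hσ, Finset.smul_sum]
  rfl

/-- The channel that reads a classical bit from its auxiliary input and applies `φ₀` or `φ₁`
accordingly. -/
def controlled {A A' X X' : Type} (φ₀ φ₁ : SuperOp (A × X) (A' × X')) :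
    SuperOp (A × (X × Bool)) (A' × X') :=
  φ₀ ∘ₗ ampL A (blockR false false) + φ₁ ∘ₗ ampL A (blockR true true)

/-- Dilation extensions of a convex set are closed under classical control: reducing a controlled
channel gives the mixture, with weights given by the control state, of reductions of its two
branches. -/
theorem controlled_mem_dExt {A A' X X' : Type} [Fintype A] [Fintype A'] [Fintype X] [Fintype X']
    {K : Set (SuperOp A A')} (hK : Convex ℝ K) {φ₀ φ₁ : SuperOp (A × X) (A' × X')}
    (h₀ : φ₀ ∈ dExt X X' K) (h₁ : φ₁ ∈ dExt X X' K) :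
    controlled φ₀ φ₁ ∈ dExt (X × Bool) X' K := by
  refine ⟨⟨(h₀.1.1.comp (isCP_ampL (isCP_blockR _) A)).add
    (h₁.1.1.comp (isCP_ampL (isCP_blockR _) A)), fun P => ?_⟩, fun ρ hρ σ hσ => ?_⟩
  · rw [controlled, LinearMap.add_apply, Matrix.trace_add, LinearMap.comp_apply,
      LinearMap.comp_apply, h₀.1.2, h₁.1.2]
    have h : ∀ c, (ampL A (blockR c c : SuperOp (X × Bool) X) P).trace =
        ∑ a, ∑ x, P (a, (x, c)) (a, (x, c)) := fun c => Fintype.sum_prod_type _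
    rw [h, h]
    simp [Matrix.trace, Fintype.sum_prod_type, Finset.sum_add_distrib, add_comm]
  · have hd := comp_mem_QC (discardR_mem_QC X Bool) hρ
    obtain ⟨w₀, hw₀, ht₀, ρ₀, hρ₀, e₀⟩ :=
      exists_eq_smul_state ((isCP_blockR false).comp hρ.1) hd
    obtain ⟨w₁, hw₁, ht₁, ρ₁, hρ₁, e₁⟩ :=
      exists_eq_smul_state ((isCP_blockR true).comp hρ.1) hd
    have hw : w₀ + w₁ = 1 := by
      have h := hρ.2 1
      have h' : (ρ 1).trace = ((blockR false false ∘ₗ ρ) 1).trace +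
          ((blockR true true ∘ₗ ρ) 1).trace := by
        change ∑ p, ρ 1 p p = ∑ x, ρ 1 (x, false) (x, false) + ∑ x, ρ 1 (x, true) (x, true)
        simp [Fintype.sum_prod_type, Finset.sum_add_distrib, add_comm]
      rw [h', ht₀, ht₁] at h
      simp at h
      exact_mod_cast h
    have key : reduce (controlled φ₀ φ₁) ρ σ =
        reduce φ₀ (blockR false false ∘ₗ ρ) σ + reduce φ₁ (blockR true true ∘ₗ ρ) σ :=
      reduce_add _ _ _ _
    rw [key, e₀, e₁, reduce_smul _ _ _ hσ, reduce_smul _ _ _ hσ]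
    exact hK (h₀.2 _ hρ₀ _ hσ) (h₁.2 _ hρ₁ _ hσ) hw₀ hw₁ hw

theorem rightUnitorInv_comp_mem_QC {X Y : Type} [Fintype X] [Fintype Y] {f : SuperOp Y X}
    (hf : f ∈ QC Y X) : rightUnitorInv X ∘ₗ f ∈ QC Y (X × Unit) :=
  comp_mem_QC (relabel_mem_QC _) hf

theorem comp_rightUnitor_mem_QC {X Y : Type} [Fintype X] [Fintype Y] {g : SuperOp X Y}
    (hg : g ∈ QC X Y) : g ∘ₗ rightUnitor X ∈ QC (X × Unit) Y :=
  comp_mem_QC hg (relabel_mem_QC _)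

theorem plug_rightUnitor {A A' X X' Y Y' : Type} (f : SuperOp Y X) (g : SuperOp X' Y')
    (φ : SuperOp (A × X) (A' × X')) :
    plug (rightUnitorInv X ∘ₗ f) (g ∘ₗ rightUnitor X') φ = ampL A' g ∘ₗ φ ∘ₗ ampL A f := rfl

theorem ampL_add {A B : Type} (Z : Type) (f g : SuperOp A B) :
    ampL Z (f + g) = ampL Z f + ampL Z g := rfl

theorem ampL_smul {A B : Type} (Z : Type) (r : ℝ) (f : SuperOp A B) :
    ampL Z (r • f) = r • ampL Z f := rfl

theorem mix_mem_QC {A B : Type} [Fintype A] [Fintype B] {f g : SuperOp A B} (hf : f ∈ QC A B)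
    (hg : g ∈ QC A B) {s t : ℝ} (hs : 0 ≤ s) (ht : 0 ≤ t) (h : s + t = 1) :
    s • f + t • g ∈ QC A B := by
  refine ⟨(hf.1.smul hs).add (hg.1.smul ht), fun P => ?_⟩
  rw [LinearMap.add_apply, Matrix.trace_add, LinearMap.smul_apply, LinearMap.smul_apply,
    Matrix.trace_smul, Matrix.trace_smul, hf.2, hg.2, ← add_smul, h, one_smul]

theorem controlled_comp_flag {A A' X X' : Type} (φ₀ φ₁ : SuperOp (A × X) (A' × X')) (s t : ℝ) :
    controlled φ₀ φ₁ ∘ₗ ampL A (s • flag X false + t • flag X true) = s • φ₀ + t • φ₁ := by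
  have h : ∀ c d : Bool, ampL A (blockR c c) ∘ₗ ampL A (flag X d) =
      if c = d then LinearMap.id else (0 : SuperOp (A × X) (A × X)) := by
    intro c d
    change ampL A (blockR c c ∘ₗ flag X d) = _
    split_ifs with hcd
    · subst hcd
      rw [blockR_comp_flag_self]
      rfl
    · rw [blockR_comp_flag_of_ne (Ne.symm hcd)]
      rfl
  rw [controlled, ampL_add, ampL_smul, ampL_smul, LinearMap.add_comp, LinearMap.comp_assoc,
    LinearMap.comp_assoc]
  simp only [LinearMap.comp_add, LinearMap.comp_smul, h]
  simp

/-! ### Locally-applicable transformations -/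

namespace LocallyApplicable

variable {A A' B B' : Type} [Fintype A] [Fintype A'] [Fintype B] [Fintype B']
  {K : Set (SuperOp A A')} {M : Set (SuperOp B B')}

theorem app_congr (T : LocallyApplicable K M) {X X' : Type} [Fintype X] [Fintype X']
    {φ ψ : SuperOp (A × X) (A' × X')} (hφ : φ ∈ dExt X X' K) (hψ : ψ ∈ dExt X X' K)
    (h : φ = ψ) : (T.app X X' ⟨φ, hφ⟩).1 = (T.app X X' ⟨ψ, hψ⟩).1 := by
  subst h
  rfl

theorem comp_mem_dExt {X X' Y Y' : Type} [Fintype X] [Fintype X'] [Fintype Y] [Fintype Y']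
    {f : SuperOp Y X} {g : SuperOp X' Y'} (hf : f ∈ QC Y X) (hg : g ∈ QC X' Y')
    {φ : SuperOp (A × X) (A' × X')} (hφ : φ ∈ dExt X X' K) :
    ampL A' g ∘ₗ φ ∘ₗ ampL A f ∈ dExt Y Y' K := by
  rw [← plug_rightUnitor]
  exact plug_mem_dExt (rightUnitorInv_comp_mem_QC hf) (comp_rightUnitor_mem_QC hg) hφ

theorem app_comp (T : LocallyApplicable K M) {X X' Y Y' : Type} [Fintype X] [Fintype X']
    [Fintype Y] [Fintype Y'] {f : SuperOp Y X} {g : SuperOp X' Y'} (hf : f ∈ QC Y X)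
    (hg : g ∈ QC X' Y') {φ : SuperOp (A × X) (A' × X')} (hφ : φ ∈ dExt X X' K) :
    (T.app Y Y' ⟨ampL A' g ∘ₗ φ ∘ₗ ampL A f, comp_mem_dExt hf hg hφ⟩).1 =
      ampL B' g ∘ₗ (T.app X X' ⟨φ, hφ⟩).1 ∘ₗ ampL B f := by
  have h := T.local_app X X' Y Y' Unit _ _ (rightUnitorInv_comp_mem_QC hf)
    (comp_rightUnitor_mem_QC hg) ⟨φ, hφ⟩
  exact (T.app_congr _ _ (plug_rightUnitor f g φ).symm).trans (h.trans (plug_rightUnitor f g _))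

theorem mix_mem_dExt (hK : Convex ℝ K) {X X' : Type} [Fintype X] [Fintype X']
    {φ₀ φ₁ : SuperOp (A × X) (A' × X')} (h₀ : φ₀ ∈ dExt X X' K) (h₁ : φ₁ ∈ dExt X X' K)
    {s t : ℝ} (hs : 0 ≤ s) (ht : 0 ≤ t) (h : s + t = 1) :
    s • φ₀ + t • φ₁ ∈ dExt X X' K := by
  have hid : (LinearMap.id : SuperOp X' X') ∈ QC X' X' := ⟨isCP_id _, fun _ => rfl⟩
  have hf := mix_mem_QC (flag_mem_QC X false) (flag_mem_QC X true) hs ht h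
  have hmix := comp_mem_dExt hf hid (controlled_mem_dExt hK h₀ h₁)
  rw [← controlled_comp_flag]
  exact hmix

/-- Locally-applicable transformations preserve convex combinations, since a convex combination
is a controlled channel with a random control bit. -/
theorem app_mix (T : LocallyApplicable K M) (hK : Convex ℝ K) {X X' : Type} [Fintype X]
    [Fintype X'] {φ₀ φ₁ : SuperOp (A × X) (A' × X')} (h₀ : φ₀ ∈ dExt X X' K)
    (h₁ : φ₁ ∈ dExt X X' K) {s t : ℝ} (hs : 0 ≤ s) (ht : 0 ≤ t) (h : s + t = 1) :
    (T.app X X' ⟨s • φ₀ + t • φ₁, mix_mem_dExt hK h₀ h₁ hs ht h⟩).1 =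
      s • (T.app X X' ⟨φ₀, h₀⟩).1 + t • (T.app X X' ⟨φ₁, h₁⟩).1 := by
  have hΘ := controlled_mem_dExt hK h₀ h₁
  have hid : (LinearMap.id : SuperOp X' X') ∈ QC X' X' := ⟨isCP_id _, fun _ => rfl⟩
  have key : ∀ {s t : ℝ} (hs : 0 ≤ s) (ht : 0 ≤ t) (h : s + t = 1)
      {ψ : SuperOp (A × X) (A' × X')} (hψ : ψ ∈ dExt X X' K), s • φ₀ + t • φ₁ = ψ →
      (T.app X X' ⟨ψ, hψ⟩).1 =
        (T.app _ _ ⟨_, hΘ⟩).1 ∘ₗ ampL B (s • flag X false + t • flag X true) := by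
    intro s t hs ht h ψ hψ e
    have hf := mix_mem_QC (flag_mem_QC X false) (flag_mem_QC X true) hs ht h
    rw [← controlled_comp_flag] at e
    rw [← T.app_congr (comp_mem_dExt hf hid hΘ) hψ e, T.app_comp hf hid hΘ]
    rfl
  rw [key hs ht h _ rfl, key zero_le_one le_rfl (add_zero _) h₀ (by simp),
    key le_rfl zero_le_one (zero_add _) h₁ (by simp)]
  simp only [ampL_add, ampL_smul, LinearMap.comp_add, LinearMap.comp_smul, one_smul, zero_smul,
    zero_add, add_zero]

end LocallyApplicable

/-! ### Teleportation through the swap -/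

/-- The normalised Choi channel `X → A' ⊗ (A ⊗ X')` of `φ : A ⊗ X → A' ⊗ X'`: the channel `φ`
applied to half of a maximally entangled state. -/
noncomputable def choi {A A' X X' : Type} [Fintype A] (φ : SuperOp (A × X) (A' × X')) :
    SuperOp X (A' × (A × X')) :=
  (Fintype.card A : ℝ)⁻¹ • (relabel
    { toFun := fun p : (A × A') × X' => (p.1.2, (p.1.1, p.2))
      invFun := fun p => ((p.2.1, p.1), p.2.2)
      left_inv := fun _ => rfl
      right_inv := fun _ => rfl } ∘ₗ bendUp φ)

theorem choi_apply {A A' X X' : Type} [Fintype A] (φ : SuperOp (A × X) (A' × X'))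
    (Q : Matrix X X ℂ) (p q : A' × (A × X')) :
    choi φ Q p q = (Fintype.card A : ℂ)⁻¹ *
      bendUp φ Q ((p.2.1, p.1), p.2.2) ((q.2.1, q.1), q.2.2) := by
  have h : choi φ Q p q = (Fintype.card A : ℝ)⁻¹ •
      bendUp φ Q ((p.2.1, p.1), p.2.2) ((q.2.1, q.1), q.2.2) := rfl
  rw [h, Complex.real_smul]
  simp

theorem trace_unitTensor_self {A X : Type} [Fintype A] [Fintype X] (a : A) (Q : Matrix X X ℂ) :
    (unitTensor a a Q).trace = Q.trace := by
  classical
  simp [Matrix.trace, unitTensor_apply, Fintype.sum_prod_type]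

theorem choi_mem_QC {A A' X X' : Type} [Fintype A] [Nonempty A] [Fintype A'] [Fintype X]
    [Fintype X'] {φ : SuperOp (A × X) (A' × X')} (hφ : φ ∈ QC (A × X) (A' × X')) :
    choi φ ∈ QC X (A' × (A × X')) := by
  refine ⟨((isCP_relabel _).comp (isCP_bendUp hφ.1)).smul (by positivity), fun Q => ?_⟩
  have h : ∀ a, ∑ a', ∑ x, φ (unitTensor a a Q) (a', x) (a', x) = Q.trace := fun a => by
    rw [← trace_unitTensor_self a Q, ← hφ.2]
    exact (Fintype.sum_prod_type fun p : A' × X' => φ (unitTensor a a Q) p p).symm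
  have hd : (Fintype.card A : ℂ) ≠ 0 := by simp
  simp only [Matrix.trace, Matrix.diag, choi_apply, bendUp_apply, Fintype.sum_prod_type]
  rw [Finset.sum_comm]
  simp only [← Finset.mul_sum, h]
  simp [Matrix.trace, hd]

/-- The projection onto the maximally entangled state of `ℂ^A ⊗ ℂ^A`. -/
noncomputable def bell (A : Type) [Fintype A] [DecidableEq A] : Matrix (A × A) (A × A) ℂ :=
  Matrix.of fun u v => if u.1 = u.2 ∧ v.1 = v.2 then (Fintype.card A : ℂ)⁻¹ else 0

theorem conjTranspose_bell (A : Type) [Fintype A] [DecidableEq A] :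
    (bell A).conjTranspose = bell A := by
  ext u v
  by_cases h : u.1 = u.2 <;> by_cases h' : v.1 = v.2 <;>
    simp [bell, Matrix.conjTranspose_apply, h, h']

theorem bell_mul_bell (A : Type) [Fintype A] [DecidableEq A] [Nonempty A] :
    bell A * bell A = bell A := by
  have hd : (Fintype.card A : ℂ) ≠ 0 := by simp
  ext ⟨a, b⟩ ⟨c, d⟩
  by_cases h : a = b <;> by_cases h' : c = d <;>
    simp [bell, Matrix.mul_apply, Fintype.sum_prod_type, h, h', hd]

/-- Teleportation: feeding the Choi channel of `φ` into the auxiliary input of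
`χ : B ⊗ A' → B' ⊗ A` and projecting the two copies of `A` onto the maximally entangled state
yields, with probability `1 / |A|²`, the action on `φ` of the map obtained from `χ` by bending
wires. -/
theorem plug_choi_bell {A A' B B' X X' : Type} [Fintype A] [DecidableEq A] [Fintype B]
    (χ : SuperOp (B × A') (B' × A)) (φ : SuperOp (A × X) (A' × X')) :
    plug (choi φ) (effect (bell A) X' ∘ₗ assocInv A A X') χ =
      ((Fintype.card A : ℝ)⁻¹ ^ 2) • act (unbend χ) φ := by
  refine superOp_ext_unitTensor fun b c Q => ?_
  ext p q
  have hR : ∀ (R : Matrix (A × (A × X')) (A × (A × X')) ℂ) (x y : X'),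
      (effect (bell A) X' ∘ₗ assocInv A A X') R x y =
        ∑ a, ∑ e, (Fintype.card A : ℂ)⁻¹ * R (a, (a, x)) (e, (e, y)) := by
    intro R x y
    change ∑ u : A × A, ∑ v : A × A, bell A v u * R (u.1, (u.2, x)) (v.1, (v.2, y)) = _
    simp only [bell, Matrix.of_apply, Fintype.sum_prod_type, ite_and, ite_mul, zero_mul,
      Finset.sum_ite_eq, Finset.mem_univ, if_true, Finset.sum_ite_irrel, Finset.sum_const_zero]
  have hblock : ∀ a e, blockR (a, p.2) (e, q.2) (choi φ Q) =
      (Fintype.card A : ℂ)⁻¹ • blockL a e (blockR p.2 q.2 (bendUp φ Q)) := by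
    intro a e
    ext i j
    exact choi_apply φ Q _ _
  rw [plug_unitTensor, hR, LinearMap.smul_apply, Matrix.smul_apply, act_unitTensor, unbend_apply,
    Complex.real_smul]
  simp only [Matrix.of_apply, hblock, map_smul, Matrix.smul_apply, smul_eq_mul, Finset.mul_sum]
  push_cast
  simp only [pow_two, mul_assoc]

theorem plug_add_right {A A' X X' Y Y' Z : Type} (f : SuperOp Y (X × Z))
    (g g' : SuperOp (X' × Z) Y') (φ : SuperOp (A × X) (A' × X')) :
    plug f (g + g') φ = plug f g φ + plug f g' φ := rfl

theorem plug_comp_right {A A' X X' Y Y' Y'' Z : Type} (f : SuperOp Y (X × Z))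
    (g : SuperOp (X' × Z) Y') (h : SuperOp Y' Y'') (φ : SuperOp (A × X) (A' × X')) :
    plug f (h ∘ₗ g) φ = ampL A' h ∘ₗ plug f g φ := rfl

/-- The measurement of the maximally entangled state on two copies of `A`, with a classical
register that records a positive outcome as `false`. -/
noncomputable def bellTest (A X : Type) [Fintype A] [DecidableEq A] :
    SuperOp (A × (A × X)) (X × Bool) :=
  (flag X false ∘ₗ effect (bell A) X + flag X true ∘ₗ effect (1 - bell A) X) ∘ₗ assocInv A A X

/-- The channel that discards two copies of `A` and always records `true`. -/
noncomputable def noTest (A X : Type) [Fintype A] [DecidableEq A] :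
    SuperOp (A × (A × X)) (X × Bool) :=
  (flag X false ∘ₗ effect 0 X + flag X true ∘ₗ effect 1 X) ∘ₗ assocInv A A X

theorem bellTest_mem_QC (A X : Type) [Fintype A] [DecidableEq A] [Nonempty A] [Fintype X] :
    bellTest A X ∈ QC (A × (A × X)) (X × Bool) := by
  have h₀ : (bell A).conjTranspose * bell A = bell A := by
    rw [conjTranspose_bell, bell_mul_bell]
  have h₁ : (1 - bell A).conjTranspose * (1 - bell A) = 1 - bell A := by
    rw [Matrix.conjTranspose_sub, conjTranspose_bell, Matrix.conjTranspose_one, mul_sub, sub_mul,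
      sub_mul, bell_mul_bell]
    simp
  have h := measure_mem_QC (X := X) (L₀ := bell A) (L₁ := 1 - bell A) (by rw [h₀, h₁]; simp)
  rw [h₀, h₁] at h
  exact comp_mem_QC h (relabel_mem_QC _)

theorem noTest_mem_QC (A X : Type) [Fintype A] [DecidableEq A] [Fintype X] :
    noTest A X ∈ QC (A × (A × X)) (X × Bool) := by
  have h := measure_mem_QC (U := A × A) (X := X) (L₀ := 0) (L₁ := 1) (by simp)
  simp only [Matrix.conjTranspose_zero, Matrix.conjTranspose_one, mul_zero, mul_one] at h
  exact comp_mem_QC h (relabel_mem_QC _)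

/-- The difference of the two tests is the product of the Bell effect with the difference of the
two register states. -/
theorem bellTest_add (A X : Type) [Fintype A] [DecidableEq A] :
    bellTest A X + flag X true ∘ₗ (effect (bell A) X ∘ₗ assocInv A A X) =
      noTest A X + flag X false ∘ₗ (effect (bell A) X ∘ₗ assocInv A A X) := by
  have h0 : effect (0 : Matrix (A × A) (A × A) ℂ) X = 0 := by
    have h := effect_add (X := X) (0 : Matrix (A × A) (A × A) ℂ) 0
    simpa using h
  have h1 : effect (1 : Matrix (A × A) (A × A) ℂ) X =
      effect (1 - bell A) X + effect (bell A) X := by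
    rw [← effect_add, sub_add_cancel]
  rw [bellTest, noTest, h0, h1]
  simp only [LinearMap.add_comp, LinearMap.comp_add, LinearMap.comp_zero, LinearMap.zero_comp,
    LinearMap.comp_assoc]
  abel

theorem plug_bellTest_add {A A' B B' X X' : Type} [Fintype A] [DecidableEq A] [Fintype B]
    (χ : SuperOp (B × A') (B' × A)) (φ : SuperOp (A × X) (A' × X')) :
    plug (choi φ) (bellTest A X') χ +
        ((Fintype.card A : ℝ)⁻¹ ^ 2) • (ampL B' (flag X' true) ∘ₗ act (unbend χ) φ) =
      plug (choi φ) (noTest A X') χ +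
        ((Fintype.card A : ℝ)⁻¹ ^ 2) • (ampL B' (flag X' false) ∘ₗ act (unbend χ) φ) := by
  rw [← LinearMap.comp_smul, ← LinearMap.comp_smul, ← plug_choi_bell, ← plug_comp_right,
    ← plug_comp_right, ← plug_add_right, ← plug_add_right, bellTest_add]

/-! ### The correspondence -/

/-- The swap extends every normal set: its reductions discard the input and prepare a state. -/
theorem swap_mem_dExt {A A' : Type} [Fintype A] [Fintype A'] {K : Set (SuperOp A A')}
    (hK : IsNormal K) : swap A A' ∈ dExt A' A K := by
  refine ⟨relabel_mem_QC _, fun ρ hρ σ hσ => ?_⟩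
  have h : reduce (swap A A') ρ σ = ρ ∘ₗ discard A := by
    refine LinearMap.ext fun P => ?_
    ext i j
    have hP : discard A P = ∑ a, blockL a a (rightUnitorInv A P) := by
      ext k l
      rw [Matrix.sum_apply]
      rfl
    rw [reduce_apply _ _ hσ, LinearMap.comp_apply, hP, map_sum, Matrix.sum_apply]
    rfl
  rw [h]
  exact hK _ (discard_mem_QC A) _ hρ

theorem ampL_blockR_flag {B X Y C : Type} (i : C) (φ : SuperOp Y (B × X)) :
    ampL B (blockR i i) ∘ₗ ampL B (flag X i) ∘ₗ φ = φ := by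
  change ampL B (blockR i i ∘ₗ flag X i) ∘ₗ φ = φ
  rw [blockR_comp_flag_self]
  rfl

theorem ampL_blockR_flag_of_ne {B X Y C : Type} {i j : C} (h : i ≠ j)
    (φ : SuperOp Y (B × X)) : ampL B (blockR j j) ∘ₗ ampL B (flag X i) ∘ₗ φ = 0 := by
  change ampL B (blockR j j ∘ₗ flag X i) ∘ₗ φ = 0
  rw [blockR_comp_flag_of_ne h]
  rfl

namespace LocallyApplicable

variable {A A' B B' : Type} [Fintype A] [Fintype A'] [Fintype B] [Fintype B']
  {K : Set (SuperOp A A')} {M : Set (SuperOp B B')}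

theorem app_flag (T : LocallyApplicable K M) {X X' C : Type} [Fintype X] [Fintype X']
    [Fintype C] (i : C) {φ : SuperOp (A × X) (A' × X')} (hφ : φ ∈ dExt X X' K)
    (hφi : ampL A' (flag X' i) ∘ₗ φ ∈ dExt X (X' × C) K) :
    (T.app X (X' × C) ⟨_, hφi⟩).1 = ampL B' (flag X' i) ∘ₗ (T.app X X' ⟨φ, hφ⟩).1 :=
  T.app_comp (f := LinearMap.id) ⟨isCP_id _, fun _ => rfl⟩ (flag_mem_QC X' i) hφ

theorem flag_comp_mem_dExt {X X' C : Type} [Fintype X] [Fintype X'] [Fintype C] (i : C)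
    {φ : SuperOp (A × X) (A' × X')} (hφ : φ ∈ dExt X X' K) :
    ampL A' (flag X' i) ∘ₗ φ ∈ dExt X (X' × C) K :=
  comp_mem_dExt (f := LinearMap.id) ⟨isCP_id _, fun _ => rfl⟩ (flag_mem_QC X' i) hφ

/-- When `A` is empty, `φ` vanishes and hence so do its extensions by the register states `false`
and `true`. By locality, `T φ` then has equal extensions by these two states, so it vanishes. -/
theorem app_eq_zero_of_isEmpty (T : LocallyApplicable K M) [IsEmpty A] {X X' : Type} [Fintype X]
    [Fintype X'] {φ : SuperOp (A × X) (A' × X')} (hφ : φ ∈ dExt X X' K) :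
    (T.app X X' ⟨φ, hφ⟩).1 = 0 := by
  have h : ampL A' (flag X' false) ∘ₗ φ = ampL A' (flag X' true) ∘ₗ φ := by
    refine LinearMap.ext fun P => ?_
    rw [Subsingleton.elim P 0, map_zero, map_zero]
  have h' := T.app_congr (flag_comp_mem_dExt false hφ) (flag_comp_mem_dExt true hφ) h
  rw [T.app_flag false hφ, T.app_flag true hφ] at h'
  rw [← ampL_blockR_flag false (T.app X X' ⟨φ, hφ⟩).1, h', ampL_blockR_flag_of_ne (by simp)]

/-- A locally-applicable transformation is the action of the map obtained by bending its value
at the swap. -/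
theorem act_unbend_app_swap (T : LocallyApplicable K M) (hK : Convex ℝ K)
    (hswap : swap A A' ∈ dExt A' A K) {X X' : Type} [Fintype X] [Fintype X']
    {φ : SuperOp (A × X) (A' × X')} (hφ : φ ∈ dExt X X' K) :
    act (unbend (T.app A' A ⟨swap A A', hswap⟩).1) φ = (T.app X X' ⟨φ, hφ⟩).1 := by
  classical
  rcases isEmpty_or_nonempty A with hA | hA
  · rw [T.app_eq_zero_of_isEmpty hφ]
    refine superOp_ext_unitTensor fun b c Q => ?_
    ext p q
    rw [act_unitTensor, Subsingleton.elim (blockR p.2 q.2 (bendUp φ Q)) 0, map_zero]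
    rfl
  have hf := choi_mem_QC hφ.1
  have hg := bellTest_mem_QC A X'
  have hg' := noTest_mem_QC A X'
  have m := plug_mem_dExt hf hg hswap
  have m' := plug_mem_dExt hf hg' hswap
  have mt := flag_comp_mem_dExt true hφ
  have mf := flag_comp_mem_dExt false hφ
  have hp : 0 < (Fintype.card A : ℝ)⁻¹ ^ 2 := by positivity
  have e := plug_bellTest_add (swap A A') φ
  rw [act_unbend_swap] at e
  have e' := plug_bellTest_add (T.app A' A ⟨swap A A', hswap⟩).1 φ
  generalize (Fintype.card A : ℝ)⁻¹ ^ 2 = r at hp e e'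
  -- Dividing by `1 + r` turns both sides of `e` into convex combinations of dilation extensions.
  have hs : 0 < 1 + r := by linarith
  have hs' : 0 ≤ (1 + r)⁻¹ := by positivity
  have ht' : 0 ≤ (1 + r)⁻¹ * r := by positivity
  have hst : (1 + r)⁻¹ + (1 + r)⁻¹ * r = 1 := by field_simp
  have e₁ := congrArg (fun ψ => (1 + r)⁻¹ • ψ) e
  simp only [smul_add, smul_smul] at e₁
  have h := T.app_congr (mix_mem_dExt hK m mt hs' ht' hst) (mix_mem_dExt hK m' mf hs' ht' hst) e₁
  rw [T.app_mix hK m mt hs' ht' hst, T.app_mix hK m' mf hs' ht' hst, T.app_flag true hφ,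
    T.app_flag false hφ, T.local_app _ _ _ _ _ _ _ hf hg ⟨_, hswap⟩,
    T.local_app _ _ _ _ _ _ _ hf hg' ⟨_, hswap⟩, mul_smul, mul_smul, ← smul_add, ← smul_add] at h
  have h₂ := smul_right_injective _ (inv_ne_zero hs.ne') h
  -- Only the block of the register state `false` is needed to compare the two maps.
  have c := congrArg (fun ψ => ampL B' (blockR false false) ∘ₗ ψ) h₂
  have c' := congrArg (fun ψ => ampL B' (blockR false false) ∘ₗ ψ) e'
  simp only [LinearMap.comp_add, LinearMap.comp_smul, ampL_blockR_flag,
    ampL_blockR_flag_of_ne (show true ≠ false by simp), smul_zero, add_zero] at c c'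
  rw [c] at c'
  exact (smul_right_injective _ hp.ne' (add_left_cancel c')).symm

theorem ext_app {T T' : LocallyApplicable K M}
    (h : ∀ (X X' : Type) [Fintype X] [Fintype X'] (φ : dExt X X' K),
      (T.app X X' φ).1 = (T'.app X X' φ).1) : T = T' := by
  cases T
  cases T'
  congr
  funext X X' _ _ φ
  exact Subtype.ext (h X X' φ)

end LocallyApplicable

theorem QuantumSupermap.ext_toMap {A A' B B' : Type} [Fintype A] [Fintype A'] [Fintype B]
    [Fintype B'] {K : Set (SuperOp A A')} {M : Set (SuperOp B B')} {S S' : QuantumSupermap K M}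
    (h : S.toMap = S'.toMap) : S = S' := by
  cases S
  cases S'
  congr

end QuantumSupermaps

open QuantumSupermaps
theorem mainTheorem1 {A A' B B' : Type} [Fintype A] [Fintype A'] [Fintype B] [Fintype B']
    (K : Set (SuperOp A A')) (M : Set (SuperOp B B'))
    (hK : K ⊆ QC A A') (hM : M ⊆ QC B B')
    (hKconv : Convex ℝ K) (hMconv : Convex ℝ M)
    (hKnorm : IsNormal K) (hMnorm : IsNormal M) :
    ∃ (hswap : swap A A' ∈ dExt A' A K)
      (F : QuantumSupermap K M ≃ LocallyApplicable K M),
      (∀ (S : QuantumSupermap K M) (X X' : Type) [Fintype X] [Fintype X'] (φ : dExt X X' K),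
        ((F S).app X X' φ : SuperOp (B × X) (B' × X')) = act S.toMap φ.1) ∧
      ∀ T : LocallyApplicable K M,
        (F.symm T).toMap = unbend (T.app A' A ⟨swap A A', hswap⟩).1 := by
  have hswap := swap_mem_dExt hKnorm
  exact ⟨hswap,
    { toFun := fun S =>
        { app := fun X X' _ _ φ => ⟨act S.toMap φ.1, S.act_mem X X' φ.1 φ.2⟩
          local_app := fun _ _ _ _ _ _ _ _ _ _ f g _ _ φ => act_plug S.toMap f g φ.1 }
      invFun := fun T =>
        { toMap := unbend (T.app A' A ⟨swap A A', hswap⟩).1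
          cp := isCP_unbend (T.app A' A ⟨swap A A', hswap⟩).2.1.1
          act_mem := fun X X' _ _ φ hφ => by
            rw [T.act_unbend_app_swap hKconv hswap hφ]
            exact (T.app X X' ⟨φ, hφ⟩).2 }
      left_inv := fun S => QuantumSupermap.ext_toMap (unbend_act_swap S.toMap)
      right_inv := fun T => LocallyApplicable.ext_app fun X X' _ _ φ =>
        T.act_unbend_app_swap hKconv hswap φ.2 },
    fun _ _ _ _ _ _ => rfl, fun _ => rfl⟩
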